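/- Let $G$ be a finite, nonempty bridgeless cubic planar graph; multiple edges are allowed, a loop counts twice in the degree of its end, and $G$ need not be connected. Fix any embedding of $G$ in the plane (vertices are distinct points, edges are simple arcs, loops simple closed curves, meeting vertices and other edges only at their ends). Call an edge $e$ of $G$ \emph{admissible} if the graph obtained from $G$ by deleting $e$ and smoothing out its two ends, which then have degree two, is again a bridgeless cubic graph. (Smoothing out a vertex $w$ with two edges $wx$, $wy$, where $x, y \neq w$, replaces $w$ and these edges by one edge $xy$, a loop if $x=y$; if the only edge at $w$ is a loop, then $w$ and its loop are removed. The graph without vertices counts as cubic and bridgeless.) Then for every face $F$ of the embedding, that is, for every connected component $F$ of the complement of the drawing in the plane, there is an admissible edge of $G$ that lies entirely on the boundary of $F$. -/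

import Mathlib

open scoped Graph

namespace Graph

variable {α β : Type*}

/-- The degree of the vertex `v` in the multigraph `G`; every loop at `v` counts twice. -/
noncomputable def eDegree (G : Graph α β) (v : α) : ℕ∞ :=
  {e | G.IsNonloopAt e v}.encard + 2 * {e | G.IsLoopAt e v}.encard

/-- `G` is cubic: all its vertices have degree three. -/
def IsCubic (G : Graph α β) : Prop :=
  ∀ v ∈ V(G), G.eDegree v = 3

/-- The vertices `x` and `y` are joined by a walk in `G`. -/
def Joined (G : Graph α β) (x y : α) : Prop :=
  Relation.ReflTransGen G.Adj x y

/-- The edge `e` is a bridge of `G`: its ends lie in different components of `G - e`. -/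
def IsBridge (G : Graph α β) (e : β) : Prop :=
  ∃ x y, G.IsLink e x y ∧ ¬ (G.deleteEdges {e}).Joined x y

/-- `G` has no bridge. (It may be disconnected.) -/
def IsBridgeless (G : Graph α β) : Prop :=
  ∀ e, ¬ G.IsBridge e

/-- `H'` arises from `H` by smoothing out the vertex `w` of degree two.

* If `w` has two distinct edges `f`, `g`, with other ends `x`, `y`, then `w`, `f`, `g` are replaced
  by a single edge from `x` to `y`, which is a loop when `x = y`; the new edge reuses the name `f`.
* If the only edge at `w` is a loop, then `w` and this loop form a whole component. Smoothing turns
  it into a closed curve without vertices, which is not part of a graph any more. -/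
def IsSmoothing (H : Graph α β) (w : α) (H' : Graph α β) : Prop :=
  (∃ f g x y, f ≠ g ∧ x ≠ w ∧ y ≠ w ∧ H.IsLink f w x ∧ H.IsLink g w y ∧
    (∀ h, H.Inc h w → h = f ∨ h = g) ∧
    V(H') = V(H) \ {w} ∧
    ∀ h a b, H'.IsLink h a b ↔
      (H.deleteVerts {w}).IsLink h a b ∨ (h = f ∧ s(a, b) = s(x, y))) ∨
  (∃ f, H.IsLoopAt f w ∧ (∀ h, H.Inc h w → h = f) ∧ H' = H.deleteVerts {w})

/-- `G'` arises from `G` by deleting the edge `e` and smoothing out its two ends, which have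
degree two after the deletion. -/
def IsEdgeReduction (G : Graph α β) (e : β) (G' : Graph α β) : Prop :=
  ∃ u v H, G.IsLink e u v ∧ (G.deleteEdges {e}).IsSmoothing u H ∧ H.IsSmoothing v G'

/-- The edge `e` of `G` is admissible: deleting it and smoothing out its ends leaves a bridgeless
cubic graph. -/
def IsAdmissible (G : Graph α β) (e : β) : Prop :=
  ∃ G' : Graph α β, G.IsEdgeReduction e G' ∧ G'.IsCubic ∧ G'.IsBridgeless

/-- An embedding of the multigraph `G` in the plane, which is `ℂ` with its usual topology.
Vertices are drawn as distinct points, an edge that is not a loop as a simple arc between its ends,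
a loop as a simple closed curve through its end, and a curve meets the vertices and the other
curves only at its ends. The values of `point` and `curve` outside `V(G)` and `E(G)` are irrelevant. -/
structure PlaneEmbedding (G : Graph α β) where
  /-- The point that represents a vertex. -/
  point : α → ℂ
  /-- The curve that represents an edge. -/
  curve : β → unitInterval → ℂ
  point_injOn : Set.InjOn point V(G)
  continuous_curve : ∀ e ∈ E(G), Continuous (curve e)
  curve_ends : ∀ e ∈ E(G), ∃ x y, G.IsLink e x y ∧ curve e 0 = point x ∧ curve e 1 = point y
  curve_simple : ∀ e ∈ E(G), ∀ s t, curve e s = curve e t →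
    s = t ∨ (s = 0 ∧ t = 1) ∨ (s = 1 ∧ t = 0)
  curve_ne_point : ∀ e ∈ E(G), ∀ v ∈ V(G), ∀ t ∈ Set.Ioo (0 : unitInterval) 1,
    curve e t ≠ point v
  curve_disjoint : ∀ e ∈ E(G), ∀ f ∈ E(G), e ≠ f →
    ∀ s ∈ Set.Ioo (0 : unitInterval) 1, ∀ t ∈ Set.Ioo (0 : unitInterval) 1,
      curve e s ≠ curve f t

namespace PlaneEmbedding

variable {G : Graph α β}

/-- The point set of the drawing: all vertices and all edges. -/
def support (D : G.PlaneEmbedding) : Set ℂ :=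
  D.point '' V(G) ∪ ⋃ e ∈ E(G), Set.range (D.curve e)

/-- `F` is a face: a connected component of the complement of the drawing. -/
def IsFace (D : G.PlaneEmbedding) (F : Set ℂ) : Prop :=
  ∃ z ∈ D.supportᶜ, F = connectedComponentIn D.supportᶜ z

/-- The edge `e` lies on the boundary of `F`. -/
def IsBoundaryEdge (D : G.PlaneEmbedding) (F : Set ℂ) (e : β) : Prop :=
  e ∈ E(G) ∧ Set.range (D.curve e) ⊆ frontier F

end PlaneEmbedding

end Graph

/-!
A compact set `K` does not separate `z` from `w` in the plane exactly when `(x - z) / (x - w)` has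
a continuous logarithm on `K` (Eilenberg). Logarithms on two sets that meet in at most one point can
be glued, so adding to `K` an arc that meets it at most at one end separates nothing new. Hence no
boundary edge of a face `F` ends at a vertex where it is the only boundary edge, and `F` has a
boundary edge.

In a finite bridgeless cubic graph, a nonempty set of edges without such ends has a member that lies
in no cut with two edges. Otherwise take a minimal side `A` of a 2-edge cut that contains a member
`e`, and a second member `p` at the end of `e` in `A`. Then `p` is inside `A`, and by submodularity
a 2-edge cut through `p` has a side whose intersection with `A` is a smaller side of such a cut.
Deleting an edge that lies in no 2-edge cut creates no bridge, and smoothing a vertex keeps the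
other degrees and creates no new cuts.
-/

namespace PlaneSeparation

open Set Complex Topology

section Components

variable {X : Type*} [TopologicalSpace X] {U F s : Set X} {x z : X}

lemma mem_connectedComponentIn_of_mem_closure [LocallyConnectedSpace X] (hU : IsOpen U)
    (hxU : x ∈ U) (hx : x ∈ closure (connectedComponentIn U z)) :
    x ∈ connectedComponentIn U z := by
  obtain ⟨y, hyx, hyz⟩ := mem_closure_iff.1 hx _ (hU.connectedComponentIn (x := x))
    (mem_connectedComponentIn hxU)
  rw [connectedComponentIn_eq hyz, ← connectedComponentIn_eq hyx]
  exact mem_connectedComponentIn hxU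

lemma frontier_connectedComponentIn_subset_compl [LocallyConnectedSpace X] (hU : IsOpen U)
    (z : X) : frontier (connectedComponentIn U z) ⊆ Uᶜ := by
  intro x hx hxU
  rw [hU.connectedComponentIn.frontier_eq] at hx
  exact hx.2 (mem_connectedComponentIn_of_mem_closure hU hxU hx.1)

lemma subset_of_disjoint_frontier (hs : IsPreconnected s) (hzs : z ∈ s) (hzF : z ∈ F)
    (hsF : Disjoint s (frontier F)) : s ⊆ F := by
  have hint : s ∩ closure F ⊆ interior F := fun x hx ↦ by
    by_contra h
    exact disjoint_left.1 hsF hx.1 ⟨hx.2, h⟩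
  refine (IsPreconnected.subset_left_of_subset_union (v := (closure F)ᶜ) isOpen_interior
    isClosed_closure.isOpen_compl ?_ ?_ ⟨z, hzs, hint ⟨hzs, subset_closure hzF⟩⟩ hs).trans
    interior_subset
  · exact disjoint_compl_right.mono_left (interior_subset.trans subset_closure)
  · exact fun x hx ↦ (em (x ∈ closure F)).imp (fun h ↦ hint ⟨hx, h⟩) id

end Components

lemma isPreconnected_compl_closedBall (z : ℂ) {R : ℝ} (hR : 0 < R) :
    IsPreconnected (Metric.closedBall z R)ᶜ := by
  have h : (Metric.closedBall z R)ᶜ = (fun s ↦ z + exp s) '' {s | Real.log R < s.re} := by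
    ext x
    simp only [mem_compl_iff, Metric.mem_closedBall, dist_eq_norm, not_le, mem_image, mem_ofPred_eq]
    constructor
    · intro hx
      have hx0 : x - z ≠ 0 := norm_pos_iff.1 (hR.trans hx)
      refine ⟨log (x - z), ?_, by rw [exp_log hx0]; ring⟩
      rw [log_re]
      exact Real.log_lt_log hR hx
    · rintro ⟨s, hs, rfl⟩
      rw [add_sub_cancel_left, norm_exp, ← Real.exp_log hR]
      exact Real.exp_lt_exp.2 hs
  rw [h]
  exact (convex_halfSpace_re_gt _).isPreconnected.image _ (by fun_prop)

lemma exists_continuous_log {X : Type*} [TopologicalSpace X] [SimplyConnectedSpace X]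
    [LocallyPathConnectedSpace X] {g : X → ℂ} (hg : Continuous g) (h0 : ∀ x, g x ≠ 0) :
    ∃ f : X → ℂ, Continuous f ∧ ∀ x, exp (f x) = g x := by
  have hX : IsSimplyConnected (univ : Set X) :=
    (Homeomorph.Set.univ X).toHomotopyEquiv.simplyConnectedSpace_iff.2 inferInstance
  obtain ⟨f, hf, hfg⟩ := exists_continuousOn_eqOn_exp_comp hX isOpen_univ hg.continuousOn
    (by simpa using h0)
  exact ⟨f, continuousOn_univ.1 hf, fun x ↦ hfg (mem_univ x)⟩

lemma not_exists_continuousOn_log_sphere (z : ℂ) {R : ℝ} (hR : 0 < R) :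
    ¬ ∃ L : ℂ → ℂ, ContinuousOn L (Metric.sphere z R) ∧
      ∀ x ∈ Metric.sphere z R, exp (L x) = x - z := by
  rintro ⟨L, hL, h⟩
  have hmem : ∀ t, circleMap z R t ∈ Metric.sphere z R := circleMap_mem_sphere z hR.le
  -- Along the circle the logarithm is `t * I` up to a constant, so it does not close up.
  have hexp : ∀ t : ℝ, exp (L (circleMap z R t) - t * I) = R := fun t ↦ by
    rw [exp_sub, h _ (hmem t), circleMap_sub_center, circleMap_zero,
      mul_div_cancel_right₀ _ (exp_ne_zero _)]
  have hconst := isCoveringMap_exp.const_of_comp (g := fun t : ℝ ↦ L (circleMap z R t) - t * I)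
    ((hL.comp_continuous (continuous_circleMap z R) hmem).sub (by fun_prop))
    (fun s t ↦ Subtype.ext ((hexp s).trans (hexp t).symm)) (2 * Real.pi) 0
  have hperiod := periodic_circleMap z R 0
  rw [zero_add] at hperiod
  simp [hperiod, Real.pi_ne_zero] at hconst

/-- Eilenberg's criterion: for `z` and `w` outside of a compact set `K`, the function
`(x - z) / (x - w)` has a continuous logarithm on `K` if and only if `K` does not separate `z` from
`w`. The quotient is multiplied out, so that no division by zero occurs in the definition. -/
def HasLogOn (K : Set ℂ) (z w : ℂ) : Prop :=
  ∃ φ : ℂ → ℂ, ContinuousOn φ K ∧ ∀ x ∈ K, exp (φ x) * (x - w) = x - z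

variable {K F U : Set ℂ} {z w x : ℂ}

lemma HasLogOn.symm (h : HasLogOn K z w) : HasLogOn K w z := by
  obtain ⟨φ, hφ, h⟩ := h
  refine ⟨fun x ↦ -φ x, hφ.neg, fun x hx ↦ ?_⟩
  rw [← h x hx, ← mul_assoc, ← exp_add, neg_add_cancel, exp_zero, one_mul]

lemma HasLogOn.trans {v : ℂ} (h₁ : HasLogOn K z w) (h₂ : HasLogOn K w v) : HasLogOn K z v := by
  obtain ⟨φ, hφ, h₁⟩ := h₁
  obtain ⟨ψ, hψ, h₂⟩ := h₂
  refine ⟨fun x ↦ φ x + ψ x, hφ.add hψ, fun x hx ↦ ?_⟩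
  rw [← h₁ x hx, ← h₂ x hx, exp_add, mul_assoc]

lemma HasLogOn.union {γ : Set ℂ} (hK : IsClosed K) (hγ : IsClosed γ)
    (hsub : (K ∩ γ).Subsingleton) (hwK : w ∉ K)
    (h₁ : HasLogOn K z w) (h₂ : HasLogOn γ z w) : HasLogOn (K ∪ γ) z w := by
  classical
  obtain ⟨φ, hφ, h₁⟩ := h₁
  obtain ⟨ψ, hψ, h₂⟩ := h₂
  -- At a single point two logarithms differ by a period, which can be added to one of them.
  obtain ⟨d, hd, hd1⟩ : ∃ d : ℂ, (∀ x ∈ K ∩ γ, φ x = ψ x + d) ∧ exp d = 1 := by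
    rcases (K ∩ γ).eq_empty_or_nonempty with h | ⟨p, hp⟩
    · exact ⟨0, by simp [h], exp_zero⟩
    · refine ⟨φ p - ψ p, fun x hx ↦ by rw [hsub hx hp]; ring, ?_⟩
      have hpw : p - w ≠ 0 := sub_ne_zero.2 fun h ↦ hwK (h ▸ hp.1)
      have := (h₁ p hp.1).trans (h₂ p hp.2).symm
      rw [exp_sub, mul_right_cancel₀ hpw this, div_self (exp_ne_zero _)]
  refine ⟨fun x ↦ if x ∈ K then φ x else ψ x + d, ?_, fun x hx ↦ ?_⟩
  · refine ContinuousOn.union_of_isClosed (hφ.congr fun x hx ↦ if_pos hx) ?_ hK hγ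
    refine (hψ.add (continuousOn_const (c := d))).congr fun x hx ↦ ?_
    by_cases hxK : x ∈ K
    · simp only [if_pos hxK, hd x ⟨hxK, hx⟩, Pi.add_apply]
    · simp only [if_neg hxK, Pi.add_apply]
  · by_cases hxK : x ∈ K
    · simp only [if_pos hxK, h₁ x hxK]
    · simp only [if_neg hxK, exp_add, hd1, mul_one, h₂ x (hx.resolve_left hxK)]

lemma hasLogOn_of_forall_norm_sub_lt (h : ∀ x ∈ K, ‖z - w‖ < ‖x - z‖) : HasLogOn K w z := by
  have hne : ∀ x ∈ K, x - z ≠ 0 := fun x hx ↦ norm_pos_iff.1 ((norm_nonneg _).trans_lt (h x hx))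
  have hslit : ∀ x ∈ K, 1 + (z - w) / (x - z) ∈ slitPlane := fun x hx ↦ by
    apply mem_slitPlane_of_norm_lt_one
    rw [norm_div, div_lt_one (norm_pos_iff.2 (hne x hx))]
    exact h x hx
  refine ⟨fun x ↦ log (1 + (z - w) / (x - z)), ?_, fun x hx ↦ ?_⟩
  · refine ContinuousOn.clog ?_ hslit
    exact continuousOn_const.add (continuousOn_const.div (by fun_prop) hne)
  · rw [exp_log (slitPlane_ne_zero (hslit x hx)), add_mul, div_mul_cancel₀ _ (hne x hx)]
    ring

lemma hasLogOn_of_mem_connectedComponentIn (hK : IsClosed K)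
    (hw : w ∈ connectedComponentIn Kᶜ z) : HasLogOn K z w := by
  have hz : z ∈ Kᶜ := connectedComponentIn_nonempty_iff.1 ⟨w, hw⟩
  refine (isPreconnected_connectedComponentIn (F := Kᶜ) (x := z)).induction₂
    (HasLogOn K) (fun x hx ↦ ?_) (fun _ _ _ _ _ _ ↦ HasLogOn.trans)
    (fun _ _ _ _ ↦ HasLogOn.symm) (mem_connectedComponentIn hz) hw
  obtain ⟨ε, hε, hball⟩ :=
    Metric.isOpen_iff.1 hK.isOpen_compl x (connectedComponentIn_subset _ _ hx)
  refine mem_nhdsWithin_of_mem_nhds (Filter.mem_of_superset (Metric.ball_mem_nhds x hε) ?_)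
  intro y hy
  refine (hasLogOn_of_forall_norm_sub_lt fun u hu ↦ ?_).symm
  have hux : ε ≤ ‖u - x‖ := by
    by_contra! hlt
    exact hball (mem_ball_iff_norm.2 hlt) hu
  exact (mem_ball_iff_norm'.1 hy).trans_le hux

lemma HasLogOn.exists_continuous_eqOn_compl (hlog : HasLogOn K z w) (hK : IsClosed K)
    (hU : frontier U ⊆ K) (hz : z ∈ U) (hw : w ∉ U) :
    ∃ f : ℂ → ℂ, Continuous f ∧ (∀ x, f x ≠ 0) ∧ EqOn f (fun x ↦ x - z) Uᶜ := by
  classical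
  obtain ⟨φ, hφ, hlog⟩ := hlog
  obtain ⟨Φ, hΦ⟩ := ContinuousMap.exists_restrict_eq hK
    ⟨K.domRestrict φ, continuousOn_iff_continuous_domRestrict.1 hφ⟩
  have hΦφ : ∀ x ∈ K, Φ x = φ x := fun x hx ↦ DFunLike.congr_fun hΦ ⟨x, hx⟩
  refine ⟨fun x ↦ if x ∈ U then exp (Φ x) * (x - w) else x - z, ?_, fun x ↦ ?_,
    fun x hx ↦ if_neg hx⟩
  · refine continuous_if (fun x hx ↦ ?_) (by fun_prop) (by fun_prop)
    rw [hΦφ x (hU hx), hlog x (hU hx)]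
  · by_cases hx : x ∈ U
    · simp only [if_pos hx]
      exact mul_ne_zero (exp_ne_zero _) (sub_ne_zero.2 fun h ↦ hw (h ▸ hx))
    · simp only [if_neg hx]
      exact sub_ne_zero.2 fun h ↦ hx (h ▸ hz)

lemma HasLogOn.not_isBounded (hlog : HasLogOn K z w) (hK : IsClosed K) (hU : frontier U ⊆ K)
    (hz : z ∈ U) (hw : w ∉ U) : ¬ Bornology.IsBounded U := by
  intro hb
  obtain ⟨f, hf, hf0, hfU⟩ := hlog.exists_continuous_eqOn_compl hK hU hz hw
  obtain ⟨L, hL, hLf⟩ := exists_continuous_log hf hf0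
  obtain ⟨R, hR, hUR⟩ := hb.subset_ball_lt 0 z
  refine not_exists_continuousOn_log_sphere z hR ⟨L, hL.continuousOn, fun x hx ↦ ?_⟩
  exact (hLf x).trans (hfU fun hxU ↦ (Metric.mem_ball.1 (hUR hxU)).ne hx)

lemma HasLogOn.mem_connectedComponentIn_compl (hlog : HasLogOn K z w) (hK : IsCompact K)
    (hz : z ∉ K) (hw : w ∉ K) : w ∈ connectedComponentIn Kᶜ z := by
  by_contra hzw
  have hfr : ∀ u, frontier (connectedComponentIn Kᶜ u) ⊆ K := fun u ↦
    (frontier_connectedComponentIn_subset_compl hK.isClosed.isOpen_compl u).trans_eq (compl_compl K)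
  have hwz : z ∉ connectedComponentIn Kᶜ w := fun h ↦
    hzw (connectedComponentIn_eq h ▸ mem_connectedComponentIn hw)
  obtain ⟨R, hR, hKR⟩ := hK.isBounded.subset_closedBall_lt 0 0
  have houter : ∀ u, ¬ Bornology.IsBounded (connectedComponentIn Kᶜ u) →
      (Metric.closedBall (0 : ℂ) R)ᶜ ⊆ connectedComponentIn Kᶜ u := by
    intro u hu
    obtain ⟨x, hx, hxR⟩ := not_subset.1 fun h ↦ hu (Metric.isBounded_closedBall.subset h)
    rw [connectedComponentIn_eq hx]
    exact (isPreconnected_compl_closedBall 0 hR).subset_connectedComponentIn hxR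
      (compl_subset_compl.2 hKR)
  obtain ⟨x, hx⟩ : (Metric.closedBall (0 : ℂ) R)ᶜ.Nonempty :=
    nonempty_compl.2 fun h ↦ NormedSpace.unbounded_univ ℝ ℂ (h ▸ Metric.isBounded_closedBall)
  have hxz := houter z (hlog.not_isBounded hK.isClosed (hfr z)
    (mem_connectedComponentIn hz) hzw) hx
  have hxw := houter w (hlog.symm.not_isBounded hK.isClosed (hfr w)
    (mem_connectedComponentIn hw) hwz) hx
  rw [connectedComponentIn_eq hxz, ← connectedComponentIn_eq hxw] at hzw
  exact hzw (mem_connectedComponentIn hw)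

section Arc

variable {c : unitInterval → ℂ} {s t : unitInterval}

lemma hasLogOn_image_Icc (hc : Continuous c) (hst : s ≤ t) (hinj : InjOn c (Icc s t))
    (hz : z ∉ c '' Icc s t) (hw : w ∉ c '' Icc s t) : HasLogOn (c '' Icc s t) z w := by
  -- Extending `c` to the real line by constants makes `exists_continuous_log` applicable.
  let γ : ℝ → ℂ := fun r ↦ c (projIcc s t hst (projIcc 0 1 zero_le_one r))
  have hγ : Continuous γ :=
    hc.comp (continuous_subtype_val.comp (continuous_projIcc.comp continuous_projIcc))
  have hγc : ∀ r ∈ Icc s t, γ r = c r := fun r hr ↦ by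
    simp only [γ, projIcc_val, projIcc_of_mem hst hr]
  have hne : ∀ {u}, u ∉ c '' Icc s t → ∀ r, γ r - u ≠ 0 := fun hu r ↦
    sub_ne_zero.2 fun h ↦ hu (h ▸ mem_image_of_mem _ (Subtype.coe_prop _))
  obtain ⟨L, hL, hLγ⟩ := exists_continuous_log (g := fun r ↦ (γ r - z) / (γ r - w))
    ((hγ.sub continuous_const).div (hγ.sub continuous_const) (hne hw))
    (fun r ↦ div_ne_zero (hne hz r) (hne hw r))
  have hemb : IsClosedEmbedding ((Icc s t).domRestrict c) :=
    (hc.comp continuous_subtype_val).isClosedEmbedding (injOn_iff_injective.1 hinj)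
  obtain ⟨Φ, hΦ⟩ := ContinuousMap.exists_extension hemb
    ⟨fun r : Icc s t ↦ L (r : unitInterval), by fun_prop⟩
  refine ⟨Φ, Φ.continuous.continuousOn, ?_⟩
  rintro _ ⟨r, hr, rfl⟩
  have hΦL : Φ (c r) = L r := DFunLike.congr_fun hΦ ⟨r, hr⟩
  rw [hΦL, hLγ, ← hγc r hr, div_mul_cancel₀ _ (hne hw r)]

lemma mem_connectedComponentIn_compl_union_image_Icc (hK : IsCompact K) (hc : Continuous c)
    (hst : s ≤ t) (hinj : InjOn c (Icc s t)) (hsub : (K ∩ c '' Icc s t).Subsingleton)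
    (hz : z ∉ c '' Icc s t) (hw : w ∉ c '' Icc s t) (hzw : w ∈ connectedComponentIn Kᶜ z) :
    w ∈ connectedComponentIn (K ∪ c '' Icc s t)ᶜ z := by
  have hzK : z ∉ K := connectedComponentIn_nonempty_iff.1 ⟨w, hzw⟩
  have hwK : w ∉ K := connectedComponentIn_subset _ _ hzw
  have hγ : IsCompact (c '' Icc s t) := isCompact_Icc.image hc
  have hlog : HasLogOn (K ∪ c '' Icc s t) z w :=
    (hasLogOn_of_mem_connectedComponentIn hK.isClosed hzw).union hK.isClosed hγ.isClosed hsub hwK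
      (hasLogOn_image_Icc hc hst hinj hz hw)
  exact hlog.mem_connectedComponentIn_compl (hK.union hγ) (fun h ↦ h.elim hzK hz)
    (fun h ↦ h.elim hwK hw)

lemma connectedComponentIn_sdiff_image_Icc_subset (hK : IsCompact K) (hc : Continuous c)
    (hst : s ≤ t) (hinj : InjOn c (Icc s t)) (hsub : (K ∩ c '' Icc s t).Subsingleton)
    (hF : IsPreconnected F) (hFK : Disjoint F (K ∪ c '' Icc s t))
    (hfr : frontier F ⊆ K ∪ c '' Icc s t) (hx : x ∈ closure F) (hxK : x ∉ K) :
    connectedComponentIn Kᶜ x \ c '' Icc s t ⊆ F := by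
  rintro w ⟨hxw, hw⟩
  obtain ⟨z, hz⟩ := closure_nonempty_iff.1 ⟨x, hx⟩
  rw [disjoint_union_right] at hFK
  have hzx : x ∈ connectedComponentIn Kᶜ z :=
    mem_connectedComponentIn_of_mem_closure hK.isClosed.isOpen_compl hxK
      (closure_mono (hF.subset_connectedComponentIn hz hFK.1.subset_compl_right) hx)
  rw [← connectedComponentIn_eq hzx] at hxw
  have hzw := mem_connectedComponentIn_compl_union_image_Icc hK hc hst hinj hsub
    (disjoint_left.1 hFK.2 hz) hw hxw
  refine subset_of_disjoint_frontier isPreconnected_connectedComponentIn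
    (mem_connectedComponentIn (connectedComponentIn_nonempty_iff.1 ⟨w, hzw⟩)) hz ?_ hzw
  exact (disjoint_compl_left.mono_right hfr).mono_left (connectedComponentIn_subset _ _)

lemma disjoint_union_image_Icc_image_Ioo {l : unitInterval} (hl : l < 1)
    (hinj : InjOn c (Ico 0 1)) (hKc : Disjoint K (c '' Ioo 0 1)) :
    Disjoint (K ∪ c '' Icc 0 l) (c '' Ioo l 1) := by
  refine disjoint_union_left.2 ⟨hKc.mono_right (image_mono (Ioo_subset_Ioo_left bot_le)), ?_⟩
  rw [disjoint_left]
  rintro _ ⟨r, hr, rfl⟩ ⟨q, hq, hqr⟩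
  have hrq : q = r := hinj ⟨unitInterval.nonneg', hq.2⟩ ⟨hr.1, hr.2.trans_lt hl⟩ hqr
  exact (hrq ▸ hr.2).not_gt hq.1

lemma subsingleton_inter_image_Icc {l u : unitInterval} (hlu : l < u)
    (hKc : Disjoint K (c '' Ioo l 1)) : (K ∩ c '' Icc u 1).Subsingleton := by
  refine (subsingleton_singleton (a := c 1)).anti ?_
  rintro _ ⟨hrK, r, hr, rfl⟩
  by_contra hr1
  have hrl : r ∈ Ioo l 1 := ⟨hlu.trans_le hr.1, hr.2.lt_of_ne fun h ↦ hr1 (h ▸ rfl)⟩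
  exact disjoint_left.1 hKc hrK (mem_image_of_mem c hrl)

lemma image_Ioo_subset_of_disjoint_frontier {l u : unitInterval} (hK : IsCompact K)
    (hc : Continuous c) (hinj₀ : InjOn c (Ico 0 1)) (hinj₁ : InjOn c (Ioc 0 1))
    (hKc : Disjoint K (c '' Ioo 0 1)) (hF : IsPreconnected F) (hFK : Disjoint F (K ∪ range c))
    (hfr : frontier F ⊆ K ∪ range c) (hlu : l < u) (hoff : Disjoint (c '' Ioo l u) (frontier F))
    (ht : t ∈ Ioo l 1) (htF : c t ∈ frontier F) : c '' Ioo l u ⊆ F := by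
  have hu0 : 0 < u := unitInterval.nonneg'.trans_lt hlu
  have hl1 : l < 1 := hlu.trans_le unitInterval.le_one'
  -- Removing `c '' Ioo l u` leaves two arcs. The one that ends at `c 1` meets `L` at most there, so
  -- it does not separate `c '' Ioo l u` from `F`.
  set L := K ∪ c '' Icc 0 l
  have hLc : Disjoint L (c '' Ioo l 1) := disjoint_union_image_Icc_image_Ioo hl1 hinj₀ hKc
  have hLF : Disjoint F (L ∪ c '' Icc u 1) :=
    hFK.mono_right (union_subset (union_subset_union_right K (image_subset_range c _))
      ((image_subset_range c _).trans subset_union_right))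
  have hfrL : frontier F ⊆ L ∪ c '' Icc u 1 := by
    intro x hx
    rcases hfr hx with hxK | ⟨r, rfl⟩
    · exact .inl (.inl hxK)
    · rcases le_or_gt r l with hrl | hlr
      · exact .inl (.inr ⟨r, ⟨unitInterval.nonneg', hrl⟩, rfl⟩)
      · refine .inr ⟨r, ⟨not_lt.1 fun hru ↦ ?_, unitInterval.le_one'⟩, rfl⟩
        exact disjoint_left.1 hoff ⟨r, ⟨hlr, hru⟩, rfl⟩ hx
  have hinj : InjOn c (Icc u 1) :=
    hinj₁.mono ((Icc_subset_Ioc_iff unitInterval.le_one').2 ⟨hu0, le_rfl⟩)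
  rintro _ ⟨s, hs, rfl⟩
  have hsu : c s ∉ c '' Icc u 1 := by
    rintro ⟨r, hr, hrs⟩
    have hrs' : r = s := hinj₁ ⟨hu0.trans_le hr.1, hr.2⟩
      ⟨unitInterval.nonneg'.trans_lt hs.1, unitInterval.le_one'⟩ hrs
    exact (hrs' ▸ hr.1).not_gt hs.2
  have hts : c s ∈ connectedComponentIn Lᶜ (c t) :=
    (isPreconnected_Ioo.image _ hc.continuousOn).subset_connectedComponentIn
      (mem_image_of_mem c ht) hLc.subset_compl_left
      (mem_image_of_mem c ⟨hs.1, hs.2.trans_le unitInterval.le_one'⟩)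
  exact connectedComponentIn_sdiff_image_Icc_subset (hK.union (isCompact_Icc.image hc)) hc
    unitInterval.le_one' hinj (subsingleton_inter_image_Icc hlu hLc) hF hLF hfrL htF.1
    (disjoint_right.1 hLc (mem_image_of_mem c ht)) ⟨hts, hsu⟩

lemma mem_frontier_of_lt (hK : IsCompact K) (hc : Continuous c) (hinj₀ : InjOn c (Ico 0 1))
    (hinj₁ : InjOn c (Ioc 0 1)) (hKc : Disjoint K (c '' Ioo 0 1)) (hF : IsPreconnected F)
    (hFK : Disjoint F (K ∪ range c)) (hfr : frontier F ⊆ K ∪ range c)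
    (hs : 0 < s) (ht : t < 1) (hst : s < t) (htF : c t ∈ frontier F) : c s ∈ frontier F := by
  by_contra hsF
  obtain ⟨l, u, hlu, hoff⟩ := (mem_nhds_iff_exists_Ioo_subset' ⟨0, hs⟩ ⟨t, hst⟩).1
    ((isClosed_frontier.isOpen_compl.preimage hc).mem_nhds hsF)
  have hsF' : c s ∈ F := image_Ioo_subset_of_disjoint_frontier hK hc hinj₀ hinj₁ hKc hF hFK hfr
    (hlu.1.trans hlu.2) (subset_compl_iff_disjoint_right.1 (image_subset_iff.2 hoff))
    ⟨hlu.1.trans hst, ht⟩ htF (mem_image_of_mem c hlu)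
  exact disjoint_left.1 hFK hsF' (.inr (mem_range_self s))

lemma image_Ioo_subset_frontier (hK : IsCompact K) (hc : Continuous c) (hinj₀ : InjOn c (Ico 0 1))
    (hinj₁ : InjOn c (Ioc 0 1)) (hKc : Disjoint K (c '' Ioo 0 1)) (hF : IsPreconnected F)
    (hFK : Disjoint F (K ∪ range c)) (hfr : frontier F ⊆ K ∪ range c)
    (ht : t ∈ Ioo 0 1) (htF : c t ∈ frontier F) : c '' Ioo 0 1 ⊆ frontier F := by
  rintro _ ⟨s, hs, rfl⟩
  rcases lt_trichotomy s t with hst | rfl | hts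
  · exact mem_frontier_of_lt hK hc hinj₀ hinj₁ hKc hF hFK hfr hs.1 ht.2 hst htF
  · exact htF
  let σ : unitInterval → unitInterval := unitInterval.symm
  have hσ : StrictAnti σ := unitInterval.strictAnti_symm
  have h0 : σ 0 = 1 := unitInterval.symm_zero
  have h1 : σ 1 = 0 := unitInterval.symm_one
  have hσσ : ∀ r, σ (σ r) = r := unitInterval.symm_symm
  have hσIoo : σ '' Ioo 0 1 ⊆ Ioo 0 1 := by
    simpa only [h0, h1] using (hσ.mapsTo_Ioo (a := 0) (b := 1)).image_subset
  have hrange : range (c ∘ σ) = range c := unitInterval.symm_bijective.surjective.range_comp c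
  have hrev : (c ∘ σ) (σ s) ∈ frontier F := by
    refine mem_frontier_of_lt hK (hc.comp unitInterval.continuous_symm)
      (hinj₁.comp hσ.injective.injOn ?_) (hinj₀.comp hσ.injective.injOn ?_)
      (hKc.mono_right ?_) hF (hrange ▸ hFK) (hrange ▸ hfr)
      (h1 ▸ hσ hs.2) (h0 ▸ hσ ht.1) (hσ hts) ?_
    · simpa only [h0, h1] using hσ.mapsTo_Ico (a := 0) (b := 1)
    · simpa only [h0, h1] using hσ.mapsTo_Ioc (a := 0) (b := 1)
    · exact image_comp c σ _ ▸ image_mono hσIoo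
    · simpa only [Function.comp_apply, hσσ] using htF
  simpa only [Function.comp_apply, hσσ] using hrev

end Arc

end PlaneSeparation

namespace Graph.PlaneEmbedding

open Set PlaneSeparation

variable {α β : Type*} {G : Graph α β} (D : G.PlaneEmbedding) {F : Set ℂ} {X : Set α} {Y : Set β}
  {e p : β} {a v : α} {t : unitInterval}

/-- The part of the drawing that consists of the vertices in `X` and the edges in `Y`; these
partial drawings are the compact sets to which the separation criteria are applied. -/
def drawing (X : Set α) (Y : Set β) : Set ℂ :=
  D.point '' X ∪ ⋃ e ∈ Y, range (D.curve e)

lemma isCompact_drawing (hX : X.Finite) (hY : Y.Finite) (hYE : Y ⊆ E(G)) :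
    IsCompact (D.drawing X Y) :=
  (hX.image _).isCompact.union
    (hY.isCompact_biUnion fun e he ↦ isCompact_range (D.continuous_curve e (hYE he)))

lemma mem_drawing {x : ℂ} :
    x ∈ D.drawing X Y ↔ (∃ v ∈ X, D.point v = x) ∨ ∃ e ∈ Y, ∃ t, D.curve e t = x := by
  simp only [drawing, mem_union, mem_image, mem_iUnion₂, mem_range, exists_prop]

lemma mem_support {x : ℂ} :
    x ∈ D.support ↔ (∃ v ∈ V(G), D.point v = x) ∨ ∃ e ∈ E(G), ∃ t, D.curve e t = x :=
  D.mem_drawing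

lemma support_eq_drawing_union_range (he : e ∈ E(G)) :
    D.support = D.drawing V(G) (E(G) \ {e}) ∪ range (D.curve e) := by
  have h : ⋃ f ∈ E(G), range (D.curve f) =
      range (D.curve e) ∪ ⋃ f ∈ E(G) \ {e}, range (D.curve f) := by
    rw [← biUnion_insert e _ fun f ↦ range (D.curve f), insert_sdiff_singleton,
      insert_eq_of_mem he]
  rw [support, h, union_left_comm, union_comm, drawing]

lemma curve_mem_support (he : e ∈ E(G)) (t : unitInterval) : D.curve e t ∈ D.support :=
  D.mem_support.2 (.inr ⟨e, he, t, rfl⟩)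

lemma curve_eq_point_or_mem_Ioo (he : e ∈ E(G)) (t : unitInterval) :
    (∃ v, G.Inc e v ∧ D.curve e t = D.point v) ∨ t ∈ Ioo 0 1 := by
  obtain ⟨x, y, hxy, h0, h1⟩ := D.curve_ends e he
  rcases (unitInterval.nonneg' (t := t)).eq_or_lt with rfl | ht0
  · exact .inl ⟨x, hxy.inc_left, h0⟩
  rcases (unitInterval.le_one' (t := t)).eq_or_lt with rfl | ht1
  · exact .inl ⟨y, hxy.inc_right, h1⟩
  · exact .inr ⟨ht0, ht1⟩

lemma point_mem_range_curve (h : G.Inc e v) :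
    D.point v ∈ range (D.curve e) := by
  obtain ⟨x, y, hxy, h0, h1⟩ := D.curve_ends e h.edge_mem
  rcases h.eq_or_eq_of_isLink hxy with rfl | rfl
  · exact ⟨0, h0⟩
  · exact ⟨1, h1⟩

lemma injOn_curve_Ico (he : e ∈ E(G)) : InjOn (D.curve e) (Ico 0 1) := by
  intro s hs t ht hst
  rcases D.curve_simple e he s t hst with h | ⟨-, h⟩ | ⟨h, -⟩
  · exact h
  · exact absurd h ht.2.ne
  · exact absurd h hs.2.ne

lemma injOn_curve_Ioc (he : e ∈ E(G)) : InjOn (D.curve e) (Ioc 0 1) := by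
  intro s hs t ht hst
  rcases D.curve_simple e he s t hst with h | ⟨h, -⟩ | ⟨-, h⟩
  · exact h
  · exact absurd h hs.1.ne'
  · exact absurd h ht.1.ne'

lemma injective_curve (he : G.IsNonloopAt e a) :
    Function.Injective (D.curve e) := by
  have hends : D.curve e 0 ≠ D.curve e 1 := by
    obtain ⟨x, y, hxy, h0, h1⟩ := D.curve_ends e he.edge_mem
    rw [h0, h1]
    intro h
    obtain rfl := D.point_injOn hxy.left_mem hxy.right_mem h
    obtain ⟨b, hba, hab⟩ := he
    obtain ⟨rfl, rfl⟩ | ⟨rfl, rfl⟩ := hab.eq_and_eq_or_eq_and_eq hxy <;> exact hba rfl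
  intro s t hst
  rcases D.curve_simple e he.edge_mem s t hst with h | ⟨rfl, rfl⟩ | ⟨rfl, rfl⟩
  · exact h
  · exact absurd hst hends
  · exact absurd hst.symm hends

lemma curve_notMem_drawing (hX : X ⊆ V(G)) (hY : Y ⊆ E(G)) (he : e ∈ E(G))
    (heY : e ∉ Y) (ht : t ∈ Ioo 0 1) : D.curve e t ∉ D.drawing X Y := by
  rw [mem_drawing]
  rintro (⟨v, hv, h⟩ | ⟨f, hf, s, h⟩)
  · exact D.curve_ne_point e he v (hX hv) t ht h.symm
  · rcases D.curve_eq_point_or_mem_Ioo (hY hf) s with ⟨v, hv, h'⟩ | hs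
    · exact D.curve_ne_point e he v hv.vertex_mem t ht (h ▸ h')
    · exact D.curve_disjoint e he f (hY hf) (fun h ↦ heY (h ▸ hf)) t ht s hs h.symm

lemma disjoint_drawing_image_Ioo (hX : X ⊆ V(G)) (hY : Y ⊆ E(G))
    (he : e ∈ E(G)) (heY : e ∉ Y) : Disjoint (D.drawing X Y) (D.curve e '' Ioo 0 1) := by
  rw [disjoint_right]
  rintro _ ⟨t, ht, rfl⟩
  exact D.curve_notMem_drawing hX hY he heY ht

lemma range_curve_subset_closure (he : e ∈ E(G)) :
    range (D.curve e) ⊆ closure (D.curve e '' Ioo 0 1) := by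
  rintro _ ⟨t, rfl⟩
  refine image_closure_subset_closure_image (D.continuous_curve e he) (mem_image_of_mem _ ?_)
  rw [closure_Ioo zero_ne_one]
  exact ⟨unitInterval.nonneg', unitInterval.le_one'⟩

/-- The part of the drawing that is left when the vertex `a` and all edges at `a` are erased. The
erased edges are then connected to each other through the point of `a`. -/
def drawingAway (a : α) : Set ℂ :=
  D.drawing (V(G) \ {a}) {f ∈ E(G) | ¬ G.Inc f a}

lemma isCompact_drawingAway (hV : V(G).Finite) (hE : E(G).Finite) :
    IsCompact (D.drawingAway a) :=
  D.isCompact_drawing hV.sdiff (hE.subset (sep_subset _ _)) (sep_subset _ _)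

lemma drawingAway_subset_support : D.drawingAway a ⊆ D.support :=
  union_subset_union (image_mono sdiff_subset) (biUnion_mono (sep_subset _ _) fun _ _ ↦ Subset.rfl)

lemma point_notMem_drawingAway (ha : a ∈ V(G)) : D.point a ∉ D.drawingAway a := by
  rw [drawingAway, mem_drawing]
  rintro (⟨v, hv, h⟩ | ⟨f, hf, t, h⟩)
  · exact hv.2 (D.point_injOn hv.1 ha h)
  · rcases D.curve_eq_point_or_mem_Ioo hf.1 t with ⟨v, hv, h'⟩ | ht
    · exact hf.2 (D.point_injOn hv.vertex_mem ha (h'.symm.trans h) ▸ hv)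
    · exact D.curve_ne_point f hf.1 a ha t ht h

lemma disjoint_drawingAway_image_Ioo (hp : G.Inc p a) :
    Disjoint (D.drawingAway a) (D.curve p '' Ioo 0 1) :=
  D.disjoint_drawing_image_Ioo sdiff_subset (sep_subset _ _) hp.edge_mem fun h ↦ h.2 hp

lemma curve_mem_connectedComponentIn_point (hp : G.Inc p a) (ht : t ∈ Ioo 0 1) :
    D.curve p t ∈ connectedComponentIn (D.drawingAway a)ᶜ (D.point a) := by
  have hconn : IsPreconnected (insert (D.point a) (D.curve p '' Ioo 0 1)) :=
    (isPreconnected_Ioo.image _ (D.continuous_curve p hp.edge_mem).continuousOn).subset_closure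
      (subset_insert _ _) (insert_subset
        (D.range_curve_subset_closure hp.edge_mem (D.point_mem_range_curve hp)) subset_closure)
  exact hconn.subset_connectedComponentIn (mem_insert _ _)
    (insert_subset (D.point_notMem_drawingAway hp.vertex_mem)
      (D.disjoint_drawingAway_image_Ioo hp).subset_compl_left)
    (mem_insert_of_mem _ (mem_image_of_mem _ ht))

lemma subsingleton_drawingAway_inter_range (he : G.IsNonloopAt e a) :
    (D.drawingAway a ∩ range (D.curve e)).Subsingleton := by
  obtain ⟨b, -, hab⟩ := he
  refine (subsingleton_singleton (a := D.point b)).anti ?_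
  rintro _ ⟨htK, t, rfl⟩
  rcases D.curve_eq_point_or_mem_Ioo hab.edge_mem t with ⟨v, hv, h⟩ | ht
  · rcases hv.eq_or_eq_of_isLink hab with rfl | rfl
    · exact absurd (h ▸ htK) (D.point_notMem_drawingAway hab.left_mem)
    · exact h
  · exact absurd (mem_image_of_mem _ ht)
      (disjoint_left.1 (D.disjoint_drawingAway_image_Ioo hab.inc_left) htK)

variable {D}

lemma IsBoundaryEdge.point_mem_frontier (he : D.IsBoundaryEdge F e) (hv : G.Inc e v) :
    D.point v ∈ frontier F :=
  he.2 (D.point_mem_range_curve hv)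

namespace IsFace

lemma nonempty (hF : D.IsFace F) : F.Nonempty := by
  obtain ⟨z, hz, rfl⟩ := hF
  exact ⟨z, mem_connectedComponentIn hz⟩

lemma isPreconnected (hF : D.IsFace F) : IsPreconnected F := by
  obtain ⟨z, -, rfl⟩ := hF
  exact isPreconnected_connectedComponentIn

lemma disjoint_support (hF : D.IsFace F) : Disjoint F D.support := by
  obtain ⟨z, -, rfl⟩ := hF
  exact disjoint_compl_left.mono_left (connectedComponentIn_subset _ _)

lemma frontier_subset_support (hF : D.IsFace F) (hV : V(G).Finite) (hE : E(G).Finite) :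
    frontier F ⊆ D.support := by
  obtain ⟨z, -, rfl⟩ := hF
  have hclosed : IsClosed D.support := (D.isCompact_drawing hV hE Subset.rfl).isClosed
  exact (frontier_connectedComponentIn_subset_compl hclosed.isOpen_compl z).trans_eq (compl_compl _)

lemma frontier_nonempty (hF : D.IsFace F) (hne : V(G).Nonempty) : (frontier F).Nonempty := by
  rw [nonempty_frontier_iff]
  refine ⟨hF.nonempty, fun h ↦ ?_⟩
  obtain ⟨v, hv⟩ := hne
  exact disjoint_left.1 hF.disjoint_support (h ▸ mem_univ (D.point v))
    (D.mem_support.2 (.inl ⟨v, hv, rfl⟩))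

lemma isBoundaryEdge_of_mem_frontier (hF : D.IsFace F) (hV : V(G).Finite) (hE : E(G).Finite)
    (he : e ∈ E(G)) (ht : t ∈ Ioo 0 1) (htF : D.curve e t ∈ frontier F) :
    D.IsBoundaryEdge F e := by
  have hfr := hF.frontier_subset_support hV hE
  have hdisj := hF.disjoint_support
  rw [D.support_eq_drawing_union_range he] at hfr hdisj
  have hsub : D.curve e '' Ioo 0 1 ⊆ frontier F :=
    image_Ioo_subset_frontier (D.isCompact_drawing hV hE.sdiff sdiff_subset)
      (D.continuous_curve e he) (D.injOn_curve_Ico he) (D.injOn_curve_Ioc he)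
      (D.disjoint_drawing_image_Ioo Subset.rfl sdiff_subset he
        (notMem_sdiff_of_mem (mem_singleton e)))
      hF.isPreconnected hdisj hfr ht htF
  exact ⟨he, (D.range_curve_subset_closure he).trans (closure_minimal hsub isClosed_frontier)⟩

lemma frontier_subset_drawingAway_union_range (hF : D.IsFace F) (hV : V(G).Finite)
    (hE : E(G).Finite) (hea : G.Inc e a)
    (hno : ∀ q, q ≠ e → G.Inc q a → ¬ D.IsBoundaryEdge F q) :
    frontier F ⊆ D.drawingAway a ∪ range (D.curve e) := by
  have hvertex : ∀ v ∈ V(G), D.point v ∈ D.drawingAway a ∪ range (D.curve e) := by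
    intro v hv
    by_cases hva : v = a
    · exact .inr (D.point_mem_range_curve (hva ▸ hea))
    · exact .inl (D.mem_drawing.2 (.inl ⟨v, ⟨hv, hva⟩, rfl⟩))
  intro x hx
  rcases D.mem_support.1 (hF.frontier_subset_support hV hE hx) with ⟨v, hv, rfl⟩ | ⟨f, hf, r, rfl⟩
  · exact hvertex v hv
  by_cases hfe : f = e
  · exact .inr ⟨r, hfe ▸ rfl⟩
  by_cases hfa : G.Inc f a
  · rcases D.curve_eq_point_or_mem_Ioo hf r with ⟨v, hv, h⟩ | hr
    · exact h ▸ hvertex v hv.vertex_mem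
    · exact absurd (hF.isBoundaryEdge_of_mem_frontier hV hE hf hr hx) (hno f hfe hfa)
  · exact .inl (D.mem_drawing.2 (.inr ⟨f, ⟨hf, hfa⟩, r, rfl⟩))

lemma exists_isBoundaryEdge_inc (hF : D.IsFace F) (hV : V(G).Finite) (hE : E(G).Finite)
    (haF : D.point a ∈ frontier F) (hea : G.IsNonloopAt e a) (hpa : G.Inc p a) (hpe : p ≠ e) :
    ∃ q, q ≠ e ∧ G.Inc q a ∧ D.IsBoundaryEdge F q := by
  by_contra! hno
  have hc : D.curve e '' Icc 0 1 = range (D.curve e) := by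
    rw [← image_univ, ← Icc_bot_top]
    rfl
  obtain ⟨s, hs⟩ : (Ioo (0 : unitInterval) 1).Nonempty := nonempty_Ioo.2 zero_lt_one
  have hpe' : D.curve p s ∉ range (D.curve e) := by
    rintro ⟨r, hr⟩
    exact D.curve_notMem_drawing (empty_subset _) (singleton_subset_iff.2 hea.edge_mem)
      hpa.edge_mem hpe hs (D.mem_drawing.2 (.inr ⟨e, rfl, r, hr⟩))
  -- The arc of `e` hangs at its other end, so it does not separate an inner point of `p` from `F`.
  have hsub := connectedComponentIn_sdiff_image_Icc_subset (K := D.drawingAway a) (F := F)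
    (D.isCompact_drawingAway hV hE) (D.continuous_curve e hea.edge_mem) zero_le_one
    (D.injective_curve hea).injOn (hc ▸ D.subsingleton_drawingAway_inter_range hea)
    hF.isPreconnected
    (hF.disjoint_support.mono_right (union_subset D.drawingAway_subset_support
      (image_subset_iff.2 fun r _ ↦ D.curve_mem_support hea.edge_mem r)))
    (hc ▸ hF.frontier_subset_drawingAway_union_range hV hE hea.inc hno)
    haF.1 (D.point_notMem_drawingAway hpa.vertex_mem)
  exact disjoint_left.1 hF.disjoint_support
    (hsub ⟨D.curve_mem_connectedComponentIn_point hpa hs, hc ▸ hpe'⟩)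
    (D.curve_mem_support hpa.edge_mem s)

lemma exists_isBoundaryEdge (hF : D.IsFace F) (hV : V(G).Finite) (hE : E(G).Finite)
    (hne : V(G).Nonempty) (hdeg : ∀ v ∈ V(G), {e | G.IsNonloopAt e v}.Nontrivial) :
    ∃ e, D.IsBoundaryEdge F e := by
  have hvertex : ∀ v ∈ V(G), D.point v ∈ frontier F → ∃ e, D.IsBoundaryEdge F e := by
    intro v hv hvF
    obtain ⟨e, he, p, hp, hep⟩ := hdeg v hv
    obtain ⟨q, -, -, hq⟩ := hF.exists_isBoundaryEdge_inc hV hE hvF he hp.inc hep.symm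
    exact ⟨q, hq⟩
  obtain ⟨x, hx⟩ := hF.frontier_nonempty hne
  rcases D.mem_support.1 (hF.frontier_subset_support hV hE hx) with ⟨v, hv, rfl⟩ | ⟨f, hf, r, rfl⟩
  · exact hvertex v hv hx
  rcases D.curve_eq_point_or_mem_Ioo hf r with ⟨v, hv, h⟩ | hr
  · exact hvertex v hv.vertex_mem (h ▸ hx)
  · exact ⟨f, hF.isBoundaryEdge_of_mem_frontier hV hE hf hr hx⟩

end IsFace

end Graph.PlaneEmbedding

namespace CubicReduction

open Graph Set

variable {α β : Type*} {G H H' : Graph α β} {e f g k p : β} {A C X : Set α} {a b v w x y : α}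

/-- The edges of `G` with exactly one end in `X`. Bridges are the cuts with a single edge, which
turns the statements about connectivity into statements about cuts. -/
def cut (G : Graph α β) (X : Set α) : Set β :=
  {e | ∃ x y, G.IsLink e x y ∧ x ∈ X ∧ y ∉ X}

lemma cut_subset_edgeSet : cut G X ⊆ E(G) := fun _ ⟨_, _, h, _⟩ ↦ h.edge_mem

lemma mem_cut_iff_of_isLink (h : G.IsLink e x y) : e ∈ cut G X ↔ ¬ (x ∈ X ↔ y ∈ X) := by
  constructor
  · rintro ⟨u, v, h', hu, hv⟩
    rcases h.eq_and_eq_or_eq_and_eq h' with ⟨rfl, rfl⟩ | ⟨rfl, rfl⟩ <;> tauto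
  · intro hxy
    by_cases hx : x ∈ X
    · exact ⟨x, y, h, hx, by tauto⟩
    · exact ⟨y, x, h.symm, by tauto, hx⟩

lemma cut_symmDiff (G : Graph α β) (A C : Set α) :
    cut G (symmDiff A C) = symmDiff (cut G A) (cut G C) := by
  ext e
  by_cases he : e ∈ E(G)
  · obtain ⟨x, y, h⟩ := exists_isLink_of_mem_edgeSet he
    simp only [mem_symmDiff, mem_cut_iff_of_isLink h]
    tauto
  · have hX : ∀ X, e ∉ cut G X := fun X h ↦ he (cut_subset_edgeSet h)
    simp only [mem_symmDiff, hX, false_and, or_self]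

lemma cut_compl (G : Graph α β) (X : Set α) : cut G Xᶜ = cut G X := by
  have huniv : cut G ⊤ = ⊥ :=
    eq_empty_of_forall_notMem fun _ ⟨_, y, _, _, hy⟩ ↦ hy (mem_univ y)
  rw [← hnot_eq_compl, ← symmDiff_top, cut_symmDiff, huniv, symmDiff_bot]

lemma cut_inter_vertexSet (G : Graph α β) (X : Set α) : cut G (X ∩ V(G)) = cut G X := by
  ext e
  refine exists₂_congr fun x y ↦ and_congr_right fun h ↦ ?_
  simp only [mem_inter_iff, h.left_mem, h.right_mem, and_true]

lemma cut_singleton (G : Graph α β) (v : α) : cut G {v} = {e | G.IsNonloopAt e v} := by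
  ext e
  constructor
  · rintro ⟨x, y, h, rfl, hy⟩
    exact ⟨y, hy, h⟩
  · rintro ⟨y, hy, h⟩
    exact ⟨v, y, h, rfl, hy⟩

lemma cut_deleteEdges (G : Graph α β) (Y : Set β) (X : Set α) :
    cut (G.deleteEdges Y) X = cut G X \ Y := by
  ext e
  simp only [cut, deleteEdges_isLink, mem_ofPred_eq, mem_sdiff, ← exists_and_right]
  exact exists₂_congr fun x y ↦ and_right_comm

lemma encard_cut_inter_add_encard_cut_union_le (G : Graph α β) (A C : Set α) :
    (cut G (A ∩ C)).encard + (cut G (A ∪ C)).encard ≤ (cut G A).encard + (cut G C).encard := by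
  rw [← encard_union_add_encard_inter, ← encard_union_add_encard_inter (cut G A)]
  refine add_le_add (encard_le_encard ?_) (encard_le_encard ?_)
  · intro e he
    obtain ⟨x, y, h⟩ := exists_isLink_of_mem_edgeSet
      (union_subset cut_subset_edgeSet cut_subset_edgeSet he)
    simp only [mem_union, mem_inter_iff, mem_cut_iff_of_isLink h] at he ⊢
    tauto
  · rintro e ⟨he, he'⟩
    obtain ⟨x, y, h⟩ := exists_isLink_of_mem_edgeSet (cut_subset_edgeSet he)
    simp only [mem_union, mem_inter_iff, mem_cut_iff_of_isLink h] at he he' ⊢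
    tauto

lemma _root_.Graph.Joined.mem_of_cut_eq_empty (h : G.Joined x y) (hX : cut G X = ∅)
    (hx : x ∈ X) : y ∈ X := by
  induction h with
  | refl => exact hx
  | tail _ hadj ih =>
    obtain ⟨e, he⟩ := hadj
    by_contra hc
    exact hX.subset ⟨_, _, he, ih, hc⟩

lemma isBridge_iff_exists_cut_eq_singleton : G.IsBridge e ↔ ∃ X, cut G X = {e} := by
  constructor
  · rintro ⟨x, y, hxy, hnot⟩
    refine ⟨{z | (G.deleteEdges {e}).Joined x z}, Subset.antisymm ?_ ?_⟩
    · rintro f ⟨u, v, huv, hu, hv⟩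
      by_contra hfe
      exact hv (hu.tail ⟨f, (deleteEdges_isLink ..).mpr ⟨huv, hfe⟩⟩)
    · exact singleton_subset_iff.2 ⟨x, y, hxy, .refl, hnot⟩
  · rintro ⟨X, hX⟩
    obtain ⟨x, y, hxy, hx, hy⟩ : e ∈ cut G X := hX ▸ mem_singleton e
    refine ⟨x, y, hxy, fun h ↦ hy (h.mem_of_cut_eq_empty ?_ hx)⟩
    rw [cut_deleteEdges, hX, Set.sdiff_self]

lemma _root_.Graph.IsBridgeless.cut_ne_singleton (hG : G.IsBridgeless) (X : Set α) (e : β) :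
    cut G X ≠ {e} :=
  fun h ↦ hG e (isBridge_iff_exists_cut_eq_singleton.2 ⟨X, h⟩)

lemma _root_.Graph.IsBridgeless.nontrivial_cut (hG : G.IsBridgeless) (h : (cut G X).Nonempty) :
    (cut G X).Nontrivial := by
  obtain ⟨e, he⟩ := h
  exact (nontrivial_iff_ne_singleton he).2 (hG.cut_ne_singleton X e)

lemma _root_.Graph.IsBridgeless.exists_encard_cut_eq_two (hG : G.IsBridgeless)
    (he : ¬ (G.deleteEdges {e}).IsBridgeless) : ∃ X, e ∈ cut G X ∧ (cut G X).encard = 2 := by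
  simp only [IsBridgeless, not_forall, not_not, isBridge_iff_exists_cut_eq_singleton,
    cut_deleteEdges] at he
  obtain ⟨f, X, hX⟩ := he
  have heX : e ∈ cut G X := by
    by_contra h
    exact hG.cut_ne_singleton X f (sdiff_singleton_eq_self h ▸ hX)
  refine ⟨X, heX, ?_⟩
  rw [← encard_sdiff_singleton_add_one heX, hX, encard_singleton, one_add_one_eq_two]

lemma _root_.Graph.IsBridgeless.not_isLoopAt (hG : G.IsBridgeless) (hv : G.eDegree v = 3) :
    ¬ G.IsLoopAt e v := by
  intro he
  have hloop : 1 ≤ {e | G.IsLoopAt e v}.encard := one_le_encard_iff_nonempty.2 ⟨e, he⟩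
  have hcut : (cut G {v}).encard = 1 := by
    rw [eDegree, ← cut_singleton] at hv
    generalize {e | G.IsLoopAt e v}.encard = l at hv hloop
    generalize (cut G {v}).encard = n at hv
    enat_to_nat
    all_goals norm_cast at *
    omega
  obtain ⟨f, hf⟩ := encard_eq_one.1 hcut
  exact hG.cut_ne_singleton _ _ hf

lemma _root_.Graph.IsBridgeless.encard_cut_singleton (hG : G.IsBridgeless)
    (hv : G.eDegree v = 3) : (cut G {v}).encard = 3 := by
  have hloop : {e | G.IsLoopAt e v} = ∅ := eq_empty_of_forall_notMem fun e ↦ hG.not_isLoopAt hv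
  rwa [eDegree, hloop, encard_empty, mul_zero, add_zero, ← cut_singleton] at hv

lemma _root_.Graph.IsBridgeless.mem_cut_singleton (hG : G.IsBridgeless) (hv : G.eDegree v = 3)
    (he : G.Inc e v) : e ∈ cut G {v} :=
  cut_singleton G v ▸ he.isLoopAt_or_isNonloopAt.resolve_left (hG.not_isLoopAt hv)

lemma _root_.Graph.IsBridgeless.notMem_cut_of_encard_eq_two (hG : G.IsBridgeless)
    (hv : G.eDegree v = 3) (hA : (cut G A).encard = 2) (heA : e ∈ cut G A)
    (he : e ∈ cut G {v}) (hp : p ∈ cut G {v}) (hpe : p ≠ e) : p ∉ cut G A := by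
  intro hpA
  have hpair : ({p, e} : Set β) = cut G A :=
    (toFinite {p, e}).eq_of_subset_of_encard_le (pair_subset hpA heA)
      (by rw [hA, encard_pair hpe])
  -- Moving `v` to the other side leaves only the third edge at `v` in the cut.
  have hmove : cut G (symmDiff A {v}) = cut G {v} \ {p, e} := by
    rw [cut_symmDiff, ← hpair, symmDiff_of_le (pair_subset hp he)]
  have hone : (cut G (symmDiff A {v})).encard = 1 := by
    have h := encard_sdiff_add_encard_of_subset (pair_subset hp he)
    rw [← hmove, encard_pair hpe, hG.encard_cut_singleton hv] at h
    generalize (cut G (symmDiff A {v})).encard = n at h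
    enat_to_nat
    all_goals norm_cast at *
    omega
  obtain ⟨f, hf⟩ := encard_eq_one.1 hone
  exact hG.cut_ne_singleton _ _ hf

lemma _root_.Graph.IsBridgeless.encard_cut_inter_eq_two (hG : G.IsBridgeless)
    (hA : (cut G A).encard = 2) (hC : (cut G C).encard = 2)
    (hinter : (cut G (A ∩ C)).Nonempty) (hunion : (cut G (A ∪ C)).Nonempty) :
    (cut G (A ∩ C)).encard = 2 := by
  have hi := one_lt_encard_iff_nontrivial.2 (hG.nontrivial_cut hinter)
  have hu := one_lt_encard_iff_nontrivial.2 (hG.nontrivial_cut hunion)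
  have hsub := encard_cut_inter_add_encard_cut_union_le G A C
  rw [hA, hC] at hsub
  generalize (cut G (A ∩ C)).encard = n at *
  generalize (cut G (A ∪ C)).encard = m at *
  enat_to_nat
  all_goals norm_cast at *
  omega

lemma exists_minimal_encard_cut_eq_two (hV : V(G).Finite) {P : Set β} (heP : e ∈ P)
    (he : e ∈ cut G X) (hX : (cut G X).encard = 2) :
    ∃ A, Minimal (fun A ↦ A ⊆ V(G) ∧ (cut G A).encard = 2 ∧ (cut G A ∩ P).Nonempty) A := by
  refine (hV.finite_subsets.subset fun A hA ↦ hA.1).exists_minimal ⟨X ∩ V(G), ?_⟩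
  exact ⟨inter_subset_right, by rwa [cut_inter_vertexSet], e, by rwa [cut_inter_vertexSet], heP⟩

lemma _root_.Graph.IsBridgeless.exists_isBridgeless_deleteEdges (hG : G.IsBridgeless)
    (hcubic : G.IsCubic) (hV : V(G).Finite) {P : Set β} (hP : P.Nonempty)
    (hstep : ∀ e ∈ P, ∀ a, G.Inc e a → ∃ p ∈ P, p ≠ e ∧ G.Inc p a) :
    ∃ e ∈ P, (G.deleteEdges {e}).IsBridgeless := by
  by_contra! hno
  have hcut : ∀ e ∈ P, ∃ X, e ∈ cut G X ∧ (cut G X).encard = 2 :=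
    fun e he ↦ hG.exists_encard_cut_eq_two (hno e he)
  obtain ⟨e₀, he₀⟩ := hP
  obtain ⟨X, he₀X, hX⟩ := hcut e₀ he₀
  obtain ⟨A, ⟨hAV, hA, e, heA, heP⟩, hmin⟩ := exists_minimal_encard_cut_eq_two hV he₀ he₀X hX
  obtain ⟨a, b, hab, ha, hb⟩ := id heA
  obtain ⟨p, hpP, hpe, ⟨c, hac⟩⟩ := hstep e heP a hab.inc_left
  have hdeg := hcubic a hab.left_mem
  have hpA : p ∉ cut G A := hG.notMem_cut_of_encard_eq_two hdeg hA heA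
    (hG.mem_cut_singleton hdeg hab.inc_left) (hG.mem_cut_singleton hdeg hac.inc_left) hpe
  have hc : c ∈ A := by
    by_contra hc
    exact hpA ⟨a, c, hac, ha, hc⟩
  -- On the side that misses `b`, a cut through `p` crosses `A` in a smaller cut with two edges.
  obtain ⟨C, hpC, hC, hbC⟩ : ∃ C, p ∈ cut G C ∧ (cut G C).encard = 2 ∧ b ∉ C := by
    obtain ⟨C, hpC, hC⟩ := hcut p hpP
    by_cases hbC : b ∈ C
    · exact ⟨Cᶜ, by rwa [cut_compl], by rwa [cut_compl], fun h ↦ h hbC⟩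
    · exact ⟨C, hpC, hC, hbC⟩
  have hpAC : p ∈ cut G (A ∩ C) := by
    rw [mem_cut_iff_of_isLink hac] at hpC ⊢
    simpa only [mem_inter_iff, ha, hc, true_and] using hpC
  have heAC : e ∈ cut G (A ∪ C) := ⟨a, b, hab, .inl ha, not_or.2 ⟨hb, hbC⟩⟩
  have hAC := hG.encard_cut_inter_eq_two hA hC ⟨p, hpAC⟩ ⟨e, heAC⟩
  have hsub : A ⊆ A ∩ C :=
    hmin ⟨inter_subset_left.trans hAV, hAC, p, hpAC, hpP⟩ inter_subset_left
  exact (mem_cut_iff_of_isLink hac).1 hpC (iff_of_true (hsub ha).2 (hsub hc).2)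

lemma eDegree_eq_encard_cut_add (G : Graph α β) (v : α) :
    G.eDegree v = (cut G {v}).encard + 2 * {e | G.IsLoopAt e v}.encard := by
  rw [cut_singleton, eDegree]

/-- `G` with a new edge `f` from `x` to `y`. It supplies the edge that replaces the two edges at a
smoothed vertex. -/
def addEdge (G : Graph α β) (f : β) (x y : α) (hf : f ∉ E(G)) (hx : x ∈ V(G)) (hy : y ∈ V(G)) :
    Graph α β where
  vertexSet := V(G)
  IsLink k a b := G.IsLink k a b ∨ (k = f ∧ s(a, b) = s(x, y))
  isLink_symm _ _ := ⟨fun _ _ h ↦ by rwa [isLink_comm, Sym2.eq_swap]⟩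
  eq_or_eq_of_isLink_of_isLink := by
    rintro k a b c d (h | ⟨rfl, h⟩) (h' | ⟨hk, h'⟩)
    · exact h.left_eq_or_eq h'
    · exact (hf (hk ▸ h.edge_mem)).elim
    · exact (hf h'.edge_mem).elim
    · rw [← h', Sym2.eq_iff] at h
      tauto
  left_mem_of_isLink := by
    rintro k a b (h | ⟨-, h⟩)
    · exact h.left_mem
    · rcases Sym2.eq_iff.1 h with ⟨rfl, -⟩ | ⟨rfl, -⟩ <;> assumption

/-- The first alternative of `IsSmoothing`, with the two edges `f`, `g` at `w` and their other ends
`x`, `y` made explicit: the path `x w y` becomes the edge `f`. -/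
structure IsPathSmoothing (H : Graph α β) (w : α) (f g : β) (x y : α) (H' : Graph α β) : Prop where
  ne : f ≠ g
  left_ne : x ≠ w
  right_ne : y ≠ w
  isLink_left : H.IsLink f w x
  isLink_right : H.IsLink g w y
  eq_or_eq : ∀ k, H.Inc k w → k = f ∨ k = g
  vertexSet_eq : V(H') = V(H) \ {w}
  isLink_iff : ∀ k a b, H'.IsLink k a b ↔
    (H.deleteVerts {w}).IsLink k a b ∨ (k = f ∧ s(a, b) = s(x, y))

namespace IsPathSmoothing

lemma isSmoothing (h : IsPathSmoothing H w f g x y H') : H.IsSmoothing w H' :=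
  .inl ⟨f, g, x, y, h.ne, h.left_ne, h.right_ne, h.isLink_left, h.isLink_right, h.eq_or_eq,
    h.vertexSet_eq, h.isLink_iff⟩

lemma isLink_new_iff (h : IsPathSmoothing H w f g x y H') :
    H'.IsLink f a b ↔ s(a, b) = s(x, y) := by
  refine (h.isLink_iff f a b).trans ⟨?_, fun hs ↦ .inr ⟨rfl, hs⟩⟩
  rintro (hab | ⟨-, hs⟩)
  · obtain ⟨hab, ha, hb⟩ := (deleteVerts_isLink ..).mp hab
    exact (h.isLink_left.left_eq_or_eq hab).elim (ha ·.symm) (hb ·.symm) |>.elim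
  · exact hs

lemma isLink_iff_of_ne (h : IsPathSmoothing H w f g x y H') (hk : k ≠ f) :
    H'.IsLink k a b ↔ H.IsLink k a b ∧ k ≠ g := by
  rw [h.isLink_iff, deleteVerts_isLink, or_iff_left fun hk' ↦ hk hk'.1]
  refine and_congr_right fun hab ↦ ⟨?_, ?_⟩
  · rintro ⟨ha, hb⟩ rfl
    exact (h.isLink_right.left_eq_or_eq hab).elim (ha ·.symm) (hb ·.symm)
  · intro hkg
    have hkw : ¬ H.Inc k w := fun hkw ↦ (h.eq_or_eq k hkw).elim hk hkg
    exact ⟨fun ha ↦ hkw (ha ▸ hab.inc_left), fun hb ↦ hkw (hb ▸ hab.inc_right)⟩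

lemma cut_eq (h : IsPathSmoothing H w f g x y H') (hX : w ∈ X ↔ y ∈ X) :
    cut H' X = cut H X := by
  ext k
  by_cases hk : k = f
  · subst hk
    rw [mem_cut_iff_of_isLink (h.isLink_new_iff.2 rfl), mem_cut_iff_of_isLink h.isLink_left]
    tauto
  · have hg : g ∉ cut H X := by simpa only [mem_cut_iff_of_isLink h.isLink_right, not_not]
    have hcut : k ∈ cut H' X ↔ k ∈ cut H X ∧ k ≠ g := by
      simp only [cut, mem_ofPred_eq, h.isLink_iff_of_ne hk, ← exists_and_right]
      exact exists₂_congr fun a b ↦ and_right_comm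
    exact hcut.trans (and_iff_left_of_imp fun hkX hkg ↦ hg (hkg ▸ hkX))

lemma cut_singleton_eq (h : IsPathSmoothing H w f g x y H') : cut H {w} = {f, g} := by
  rw [cut_singleton]
  refine Subset.antisymm (fun k hk ↦ h.eq_or_eq k hk.inc) (pair_subset ?_ ?_)
  · exact ⟨x, h.left_ne, h.isLink_left⟩
  · exact ⟨y, h.right_ne, h.isLink_right⟩

lemma cut_right (h : IsPathSmoothing H w f g x y H') :
    cut H' {y} = symmDiff (cut H {y}) {f, g} := by
  have hw : w ∉ V(H') := by
    rw [h.vertexSet_eq]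
    exact fun hw ↦ hw.2 rfl
  have hpair : symmDiff {y} {w} = ({y, w} : Set α) :=
    (disjoint_singleton.2 h.right_ne).symmDiff_eq_sup
  calc cut H' {y} = cut H' {y, w} := by
        rw [← cut_inter_vertexSet H' {y, w}, pair_comm, insert_inter_of_notMem hw,
          cut_inter_vertexSet]
    _ = cut H {y, w} := h.cut_eq (iff_of_true (.inr rfl) (.inl rfl))
    _ = symmDiff (cut H {y}) {f, g} := by rw [← hpair, cut_symmDiff, h.cut_singleton_eq]

lemma isLoopAt_iff (h : IsPathSmoothing H w f g x y H') (hv : v ≠ w) :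
    H'.IsLoopAt k v ↔ H.IsLoopAt k v ∨ (k = f ∧ v = x ∧ v = y) := by
  have hf : ¬ H.IsLoopAt f v := fun hf ↦ hv (hf.eq_of_inc h.isLink_left.inc_left)
  have hg : ¬ H.IsLoopAt g v := fun hg ↦ hv (hg.eq_of_inc h.isLink_right.inc_left)
  by_cases hk : k = f
  · subst hk
    rw [← isLink_self_iff, h.isLink_new_iff, Sym2.eq_iff]
    tauto
  · rw [← isLink_self_iff, h.isLink_iff_of_ne hk, isLink_self_iff,
      or_iff_left fun hk' ↦ hk hk'.1]
    exact and_iff_left_of_imp fun hkv hkg ↦ hg (hkg ▸ hkv)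

lemma mem_cut_right (h : IsPathSmoothing H w f g x y H') : g ∈ cut H {y} :=
  cut_singleton H y ▸ ⟨w, h.right_ne.symm, h.isLink_right.symm⟩

lemma eDegree_eq_of_eq (h : IsPathSmoothing H w f g y y H') : H'.eDegree y = H.eDegree y := by
  have hfg : {f, g} ⊆ cut H {y} :=
    pair_subset ((mem_cut_iff_of_isLink h.isLink_left).2 (by simp [h.left_ne.symm]))
      h.mem_cut_right
  have hloops : {k | H'.IsLoopAt k y} = insert f {k | H.IsLoopAt k y} := by
    ext k
    simp only [mem_ofPred_eq, mem_insert_iff, h.isLoopAt_iff h.right_ne]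
    tauto
  have hf : f ∉ {k | H.IsLoopAt k y} :=
    fun hf ↦ h.right_ne (hf.eq_of_inc h.isLink_left.inc_left)
  rw [eDegree_eq_encard_cut_add, eDegree_eq_encard_cut_add, h.cut_right, symmDiff_of_ge hfg, hloops,
    encard_insert_of_notMem hf, ← encard_sdiff_add_encard_of_subset hfg, encard_pair h.ne]
  ring

lemma encard_cut_right (h : IsPathSmoothing H w f g x y H') (hxy : x ≠ y) :
    (cut H' {y}).encard = (cut H {y}).encard := by
  have hf : f ∉ cut H {y} := by
    rw [mem_cut_iff_of_isLink h.isLink_left, not_not]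
    exact iff_of_false h.right_ne.symm hxy
  have hexchange : cut H' {y} = insert f (cut H {y} \ {g}) := by
    ext k
    simp only [h.cut_right, mem_symmDiff, mem_insert_iff, mem_singleton_iff, mem_sdiff]
    grind [h.ne, h.mem_cut_right]
  rw [hexchange, encard_exchange hf h.mem_cut_right]

lemma eDegree_eq (h : IsPathSmoothing H w f g x y H') (hv : v ≠ w) :
    H'.eDegree v = H.eDegree v := by
  by_cases hxy : v = x ∧ v = y
  · obtain ⟨rfl, rfl⟩ := hxy
    exact h.eDegree_eq_of_eq
  have hloops : {k | H'.IsLoopAt k v} = {k | H.IsLoopAt k v} := by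
    ext k
    exact (h.isLoopAt_iff hv).trans (or_iff_left fun hk ↦ hxy hk.2)
  have hcut : (cut H' {v}).encard = (cut H {v}).encard := by
    by_cases hvy : v = y
    · subst hvy
      exact h.encard_cut_right fun hx ↦ hxy ⟨hx.symm, rfl⟩
    · rw [h.cut_eq (iff_of_false (hv ·.symm) (hvy ·.symm))]
  rw [eDegree_eq_encard_cut_add, eDegree_eq_encard_cut_add, hcut, hloops]

end IsPathSmoothing

lemma deleteVerts_isLink_iff_of_ne (hw : ∀ k, H.Inc k w → H.IsLoopAt k w) (ha : a ≠ w) :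
    (H.deleteVerts {w}).IsLink k a b ↔ H.IsLink k a b := by
  rw [deleteVerts_isLink]
  refine and_iff_left_of_imp fun hk ↦ ⟨ha, ?_⟩
  rintro rfl
  exact ha ((hw k hk.inc_right).eq_of_inc hk.inc_left).symm

lemma cut_deleteVerts (hw : ∀ k, H.Inc k w → H.IsLoopAt k w) (X : Set α) :
    cut (H.deleteVerts {w}) X = cut H X := by
  ext k
  refine exists₂_congr fun a b ↦ and_congr_left fun hX ↦ ?_
  by_cases ha : a = w
  · subst ha
    have hb : b ≠ a := fun hb ↦ hX.2 (hb ▸ hX.1)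
    rw [isLink_comm, deleteVerts_isLink_iff_of_ne hw hb, isLink_comm]
  · exact deleteVerts_isLink_iff_of_ne hw ha

end CubicReduction

namespace Graph.IsSmoothing

open CubicReduction Set

variable {α β : Type*} {H H' : Graph α β} {v w : α}

lemma exists_isPathSmoothing_or (h : H.IsSmoothing w H') :
    (∃ f g x y, IsPathSmoothing H w f g x y H') ∨
      ((∀ k, H.Inc k w → H.IsLoopAt k w) ∧ H' = H.deleteVerts {w}) := by
  rcases h with ⟨f, g, x, y, hfg, hx, hy, hf, hg, hw, hV, hL⟩ | ⟨f, hf, hw, hH'⟩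
  · exact .inl ⟨f, g, x, y, hfg, hx, hy, hf, hg, hw, hV, hL⟩
  · exact .inr ⟨fun k hk ↦ hw k hk ▸ hf, hH'⟩

lemma vertexSet_eq (h : H.IsSmoothing w H') : V(H') = V(H) \ {w} := by
  obtain ⟨f, g, x, y, h⟩ | ⟨-, rfl⟩ := h.exists_isPathSmoothing_or
  · exact h.vertexSet_eq
  · exact vertexSet_deleteVerts ..

lemma eDegree_eq (h : H.IsSmoothing w H') (hv : v ≠ w) : H'.eDegree v = H.eDegree v := by
  obtain ⟨f, g, x, y, h⟩ | ⟨hw, rfl⟩ := h.exists_isPathSmoothing_or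
  · exact h.eDegree_eq hv
  · simp only [eDegree, IsNonloopAt, IsLoopAt, deleteVerts_isLink_iff_of_ne hw hv]

lemma exists_cut_eq (h : H.IsSmoothing w H') (X : Set α) : ∃ Y, cut H Y = cut H' X := by
  classical
  obtain ⟨f, g, x, y, h⟩ | ⟨hw, rfl⟩ := h.exists_isPathSmoothing_or
  · -- Put `w` on the side of `y`.
    let Y := Function.update id w y ⁻¹' X
    have hY : w ∈ Y ↔ y ∈ Y := by
      simp only [Y, mem_preimage, Function.update_self, Function.update_of_ne h.right_ne, id_eq]
    have hYX : Y ∩ V(H') = X ∩ V(H') := by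
      ext v
      refine and_congr_left fun hv ↦ ?_
      rw [h.vertexSet_eq] at hv
      rw [mem_preimage, Function.update_of_ne hv.2, id_eq]
    refine ⟨Y, ?_⟩
    rw [← h.cut_eq hY, ← cut_inter_vertexSet, hYX, cut_inter_vertexSet]
  · exact ⟨X, (cut_deleteVerts hw X).symm⟩

lemma isBridgeless (h : H.IsSmoothing w H') (hH : H.IsBridgeless) : H'.IsBridgeless := by
  intro e he
  obtain ⟨X, hX⟩ := isBridge_iff_exists_cut_eq_singleton.1 he
  obtain ⟨Y, hY⟩ := h.exists_cut_eq X
  exact hH.cut_ne_singleton Y e (hY.trans hX)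

end Graph.IsSmoothing

namespace CubicReduction

open Graph Set

variable {α β : Type*} {G H : Graph α β} {e : β} {v w : α}

lemma encard_eq_of_eDegree_eq_two (hw : H.eDegree w = 2) :
    ((cut H {w}).encard = 2 ∧ {e | H.IsLoopAt e w}.encard = 0) ∨
      ((cut H {w}).encard = 0 ∧ {e | H.IsLoopAt e w}.encard = 1) := by
  rw [eDegree_eq_encard_cut_add] at hw
  generalize {e | H.IsLoopAt e w}.encard = l at *
  generalize (cut H {w}).encard = n at *
  enat_to_nat
  all_goals norm_cast at *
  omega

lemma exists_isSmoothing_of_cut_eq_pair {f g : β} (hfg : f ≠ g) (hcut : cut H {w} = {f, g})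
    (hloop : ∀ e, ¬ H.IsLoopAt e w) : ∃ H', H.IsSmoothing w H' := by
  rw [cut_singleton] at hcut
  obtain ⟨x, hxw, hx⟩ : H.IsNonloopAt f w := hcut.superset (.inl rfl)
  obtain ⟨y, hyw, hy⟩ : H.IsNonloopAt g w := hcut.superset (.inr rfl)
  have hf : f ∉ E(H.deleteVerts {w}) := by
    intro hf
    obtain ⟨a, b, hab⟩ := exists_isLink_of_mem_edgeSet hf
    obtain ⟨hab, ha, hb⟩ := (deleteVerts_isLink ..).mp hab
    exact (hx.left_eq_or_eq hab).elim (ha ·.symm) (hb ·.symm)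
  have hmem : ∀ z, z ≠ w → z ∈ V(H) → z ∈ V(H.deleteVerts {w}) := fun z hzw hz ↦ ⟨hz, hzw⟩
  refine ⟨addEdge (H.deleteVerts {w}) f x y hf (hmem x hxw hx.right_mem) (hmem y hyw hy.right_mem),
    IsPathSmoothing.isSmoothing (g := g) ⟨hfg, hxw, hyw, hx, hy, fun k hk ↦ ?_,
      vertexSet_deleteVerts .., fun _ _ _ ↦ Iff.rfl⟩⟩
  exact hcut.subset (hk.isLoopAt_or_isNonloopAt.resolve_left (hloop k))

lemma exists_isSmoothing (hw : H.eDegree w = 2) : ∃ H', H.IsSmoothing w H' := by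
  rcases encard_eq_of_eDegree_eq_two hw with ⟨hcut, hloop⟩ | ⟨hcut, hloop⟩
  · obtain ⟨f, g, hfg, hcut⟩ := encard_eq_two.1 hcut
    exact exists_isSmoothing_of_cut_eq_pair hfg hcut
      (eq_empty_iff_forall_notMem.1 (encard_eq_zero.1 hloop))
  · obtain ⟨f, hf⟩ := encard_eq_one.1 hloop
    rw [encard_eq_zero, cut_singleton] at hcut
    refine ⟨H.deleteVerts {w}, .inr ⟨f, hf.superset rfl, fun k hk ↦ hf.subset ?_, rfl⟩⟩
    exact hk.isLoopAt_or_isNonloopAt.resolve_right (eq_empty_iff_forall_notMem.1 hcut k)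

lemma setOf_isLoopAt_deleteEdges (he : ¬ G.IsLoopAt e v) :
    {k | (G.deleteEdges {e}).IsLoopAt k v} = {k | G.IsLoopAt k v} := by
  ext k
  simp only [mem_ofPred_eq, deleteEdges_isLoopAt, mem_singleton_iff]
  exact and_iff_left_of_imp fun hk hke ↦ he (hke ▸ hk)

lemma eDegree_deleteEdges_of_not_inc (he : ¬ G.Inc e v) :
    (G.deleteEdges {e}).eDegree v = G.eDegree v := by
  have hcut : e ∉ cut G {v} := by
    rw [cut_singleton]
    exact fun h ↦ he h.inc
  rw [eDegree_eq_encard_cut_add, cut_deleteEdges, sdiff_singleton_eq_self hcut,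
    setOf_isLoopAt_deleteEdges fun h ↦ he h.inc, ← eDegree_eq_encard_cut_add]

lemma eDegree_deleteEdges_add_one (he : G.IsNonloopAt e v) :
    (G.deleteEdges {e}).eDegree v + 1 = G.eDegree v := by
  have hcut : e ∈ cut G {v} := cut_singleton G v ▸ he
  rw [eDegree_eq_encard_cut_add, eDegree_eq_encard_cut_add, cut_deleteEdges,
    setOf_isLoopAt_deleteEdges (he.not_isLoopAt v), ← encard_sdiff_singleton_add_one hcut]
  ring

lemma eDegree_deleteEdges_eq_two (hv : G.eDegree v = 3) (he : G.IsNonloopAt e v) :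
    (G.deleteEdges {e}).eDegree v = 2 := by
  have h := eDegree_deleteEdges_add_one he
  rw [hv] at h
  generalize (G.deleteEdges {e}).eDegree v = d at *
  enat_to_nat
  all_goals norm_cast at *
  omega

lemma _root_.Graph.IsBridgeless.isAdmissible (hG : G.IsBridgeless) (hcubic : G.IsCubic)
    (he : e ∈ E(G)) (hGe : (G.deleteEdges {e}).IsBridgeless) : G.IsAdmissible e := by
  obtain ⟨u, v, huv⟩ := exists_isLink_of_mem_edgeSet he
  have hu := hcubic u huv.left_mem
  have hv := hcubic v huv.right_mem
  have hne : v ≠ u := by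
    rintro rfl
    exact hG.not_isLoopAt hv huv
  obtain ⟨H, hH⟩ := exists_isSmoothing (eDegree_deleteEdges_eq_two hu ⟨v, hne, huv⟩)
  obtain ⟨G', hG'⟩ : ∃ G', H.IsSmoothing v G' := exists_isSmoothing <|
    (hH.eDegree_eq hne).trans (eDegree_deleteEdges_eq_two hv ⟨u, hne.symm, huv.symm⟩)
  refine ⟨G', ⟨u, v, H, huv, hH, hG'⟩, fun z hz ↦ ?_, hG'.isBridgeless (hH.isBridgeless hGe)⟩
  rw [hG'.vertexSet_eq, hH.vertexSet_eq] at hz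
  obtain ⟨⟨hzG, hzu⟩, hzv⟩ := hz
  have hinc : ¬ G.Inc e z := fun h ↦ (h.eq_or_eq_of_isLink huv).elim hzu hzv
  rw [hG'.eDegree_eq hzv, hH.eDegree_eq hzu, eDegree_deleteEdges_of_not_inc hinc, hcubic z hzG]

end CubicReduction

theorem lemma2 {α β : Type*} (G : Graph α β)
    (hVfin : V(G).Finite) (hEfin : E(G).Finite) (hne : V(G).Nonempty)
    (hcubic : G.IsCubic) (hbridgeless : G.IsBridgeless)
    (D : G.PlaneEmbedding) (F : Set ℂ) (hF : D.IsFace F) :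
    ∃ e, D.IsBoundaryEdge F e ∧ G.IsAdmissible e := by
  have hdeg : ∀ v ∈ V(G), {e | G.IsNonloopAt e v}.Nontrivial := by
    intro v hv
    rw [← CubicReduction.cut_singleton, ← Set.one_lt_encard_iff_nontrivial,
      hbridgeless.encard_cut_singleton (hcubic v hv)]
    norm_num
  have hstep : ∀ e, D.IsBoundaryEdge F e → ∀ a, G.Inc e a →
      ∃ p, D.IsBoundaryEdge F p ∧ p ≠ e ∧ G.Inc p a := by
    intro e he a hea
    have hnonloop := hea.isLoopAt_or_isNonloopAt.resolve_left
      (hbridgeless.not_isLoopAt (hcubic a hea.vertex_mem))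
    obtain ⟨p, hp, hpe⟩ := (hdeg a hea.vertex_mem).exists_ne e
    obtain ⟨q, hqe, hqa, hq⟩ := hF.exists_isBoundaryEdge_inc hVfin hEfin
      (he.point_mem_frontier hea) hnonloop hp.inc hpe
    exact ⟨q, hq, hqe, hqa⟩
  obtain ⟨e, he, hGe⟩ := hbridgeless.exists_isBridgeless_deleteEdges hcubic hVfin
    (hF.exists_isBoundaryEdge hVfin hEfin hne hdeg) hstep
  exact ⟨e, he, hbridgeless.isAdmissible hcubic he.1 hGe⟩
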